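/- Let $0<r<1$, let $G$ be a finite directed multigraph with vertices $1,\dots,p$, let $\mathcal E_{i,j}$ be the set of edges from $i$ to $j$, and let $A=(\#\mathcal E_{i,j})_{1\le i,j\le p}$ be its adjacency matrix. Let $(X,d)$ be a compact metric space and, for every edge $e$, let $S_e:X\to X$ be a similitude with ratio $r$, i.e. $d(S_e x,S_e y)=r\,d(x,y)$ for all $x,y\in X$. Let $K_1,\dots,K_p\subset X$ be nonempty compact sets such that $$K_i=\bigcup_{j}\bigcup_{e\in\mathcal E_{i,j}}S_e(K_j)\qquad(1\le i\le p),$$ and assume that they are dust-like: for every $i$ the union on the right is disjoint, i.e. the sets $S_e(K_j)$, over all $j$ and all $e\in\mathcal E_{i,j}$, are pairwise disjoint. Let $m\ge 2$ be an integer and $s=-\log m/\log r$. Then the following are equivalent: 1. there is a vector $v\in\mathbb R^p$ with all entries positive such that $Av=mv$; 2. $0<\mathcal H^s(K_i)<\infty$ for every $i=1,\dots,p$, where $\mathcal H^s$ is the $s$-dimensional Hausdorff measure. -/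

import Mathlib

open MeasureTheory
open scoped MeasureTheory Matrix ENNReal

/-- `f : X → X` is a similitude with ratio `r`. -/
def IsSimilitude {X : Type*} [MetricSpace X] (r : ℝ) (f : X → X) : Prop :=
  ∀ x y : X, dist (f x) (f y) = r * dist x y

/-- The adjacency matrix of the directed multigraph on the vertices `Fin p` whose (finite) set of
edges from `i` to `j` is `E i j`: the `(i, j)` entry is the number of those edges. -/
def adjacencyMatrix {p : ℕ} (E : Fin p → Fin p → Type*) [∀ i j, Fintype (E i j)] :
    Matrix (Fin p) (Fin p) ℝ :=
  Matrix.of fun i j => (Fintype.card (E i j) : ℝ)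

/-- `K` is the family of graph-directed sets of the maps `S e`, one for every edge `e` of the
graph: nonempty compact sets with `K i = ⋃ j, ⋃ e ∈ E i j, S e (K j)` for every vertex `i`. -/
structure IsGraphDirectedSets {p : ℕ} {X : Type*} [MetricSpace X] {E : Fin p → Fin p → Type*}
    (S : ∀ ⦃i j : Fin p⦄, E i j → X → X) (K : Fin p → Set X) : Prop where
  nonempty : ∀ i, (K i).Nonempty
  isCompact : ∀ i, IsCompact (K i)
  eq_iUnion : ∀ i, K i = ⋃ j, ⋃ e : E i j, S e '' K j

/-- `K` is a family of dust-like graph-directed sets with ratio `r`: every `S e` is a similitude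
with ratio `r`, and for every vertex `i` the sets `S e (K j)`, indexed by all edges `e` that leave
`i` (with `j` the end of `e`), are pairwise disjoint. -/
structure IsDustLike {p : ℕ} {X : Type*} [MetricSpace X] {E : Fin p → Fin p → Type*}
    (r : ℝ) (S : ∀ ⦃i j : Fin p⦄, E i j → X → X) (K : Fin p → Set X) : Prop
    extends IsGraphDirectedSets S K where
  isSimilitude : ∀ (i j : Fin p) (e : E i j), IsSimilitude r (S e)
  disjoint : ∀ i, Pairwise fun a b : (Σ j, E i j) =>
    Disjoint (S a.2 '' K a.1) (S b.2 '' K b.1)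

/-! Since `r ^ s = m⁻¹`, scaling and disjointness of the pieces give `μH[s] (K i) = m⁻¹ * ∑ μH[s] (K
j)` over the edges leaving `i`. If these measures are positive and finite, they form the required
eigenvector (`IsDustLike.hausdorffMeasure_eq`).

Conversely, an eigenvector `v` controls both bounds. Finiteness: `K i` is covered by at most `m ^ n
* v i / min v` sets of diameter at most `r ^ n * diam X`, so their `s`-sums stay bounded in `n`.
Positivity is a mass distribution argument in which finite-level weights (`cylinderMass`) replace a
limit measure: `Av = mv` keeps the total weight equal to `v i` at every level, and the separation of
the pieces bounds the weight met by `U` by a constant times `diam U ^ s`, up to an error `m⁻¹ ^ n`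
(`cylinderMass_le_diam`). -/

open Metric Set Filter Topology
open scoped NNReal

/-! ### Similitudes: scaling of Hausdorff measure and of diameters. -/

section Similitude

variable {X : Type*} [MetricSpace X] {r : ℝ} {f : X → X}

lemma IsSimilitude.edist_eq (hf : IsSimilitude r f) (hr : 0 < r) (x y : X) :
    edist (f x) (f y) = (r.toNNReal : ℝ≥0∞) * edist x y := by
  rw [edist_dist, edist_dist, hf x y, ENNReal.ofReal_mul hr.le]
  rfl

lemma IsSimilitude.lipschitzWith (hf : IsSimilitude r f) (hr : 0 < r) :
    LipschitzWith r.toNNReal f := fun x y => (hf.edist_eq hr x y).le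

lemma IsSimilitude.antilipschitzWith (hf : IsSimilitude r f) (hr : 0 < r) :
    AntilipschitzWith r.toNNReal⁻¹ f := fun x y => by
  have h : r.toNNReal ≠ 0 := by simpa using hr
  rw [hf.edist_eq hr, ← mul_assoc, ← ENNReal.coe_mul, inv_mul_cancel₀ h]
  simp

lemma IsSimilitude.hausdorffMeasure_image [MeasurableSpace X] [BorelSpace X]
    (hf : IsSimilitude r f) (hr : 0 < r) {s : ℝ} (hs : 0 ≤ s) (A : Set X) :
    μH[s] (f '' A) = ENNReal.ofReal (r ^ s) * μH[s] A := by
  have h : r.toNNReal ≠ 0 := by simpa using hr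
  have e : ENNReal.ofReal (r ^ s) = (r.toNNReal : ℝ≥0∞) ^ s := by
    rw [← ENNReal.ofReal_rpow_of_pos hr]
    rfl
  rw [e]
  refine le_antisymm ((hf.lipschitzWith hr).hausdorffMeasure_image_le hs A) ?_
  have h1 := (hf.antilipschitzWith hr).le_hausdorffMeasure_image hs A
  calc (r.toNNReal : ℝ≥0∞) ^ s * μH[s] A
      ≤ (r.toNNReal : ℝ≥0∞) ^ s * (((r.toNNReal⁻¹ : ℝ≥0) : ℝ≥0∞) ^ s * μH[s] (f '' A)) := by
        gcongr
    _ = μH[s] (f '' A) := by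
        rw [← mul_assoc, ← ENNReal.mul_rpow_of_nonneg _ _ hs, ← ENNReal.coe_mul,
          mul_inv_cancel₀ h]
        simp

lemma IsSimilitude.diam_preimage_le [CompactSpace X] (hf : IsSimilitude r f) (hr : 0 < r)
    (U : Set X) : diam (f ⁻¹' U) ≤ diam U / r := by
  refine diam_le_of_forall_dist_le (div_nonneg diam_nonneg hr.le) fun x hx y hy => ?_
  rw [le_div_iff₀ hr, mul_comm, ← hf x y]
  exact dist_le_diam_of_mem (isBounded_of_compactSpace) hx hy

end Similitude

lemma rpow_neg_log_div_log {r x : ℝ} (hr₀ : 0 < r) (hr₁ : r < 1) (hx : 0 < x) :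
    r ^ (-Real.log x / Real.log r) = x⁻¹ := by
  have h : Real.log r ≠ 0 := (Real.log_neg hr₀ hr₁).ne
  rw [Real.rpow_def_of_pos hr₀, mul_div_cancel₀ _ h, Real.exp_neg, Real.exp_log hx]

lemma adjacencyMatrix_mulVec {p : ℕ} {E : Fin p → Fin p → Type*} [∀ i j, Fintype (E i j)]
    (v : Fin p → ℝ) (i : Fin p) :
    (adjacencyMatrix E *ᵥ v) i = ∑ a : (Σ j, E i j), v a.1 := by
  rw [Fintype.sum_sigma]
  simp [Matrix.mulVec, dotProduct, adjacencyMatrix]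

lemma IsGraphDirectedSets.eq_iUnion_sigma {p : ℕ} {X : Type*} [MetricSpace X]
    {E : Fin p → Fin p → Type*} {S : ∀ ⦃i j : Fin p⦄, E i j → X → X} {K : Fin p → Set X}
    (hK : IsGraphDirectedSets S K) (i : Fin p) :
    K i = ⋃ a : (Σ j, E i j), S a.2 '' K a.1 := by
  rw [iUnion_sigma]
  exact hK.eq_iUnion i

/-! ### Finite-level mass distributions. -/

section CylinderMass

variable {p : ℕ} {X : Type*} {E : Fin p → Fin p → Type*} [∀ i j, Fintype (E i j)]

open Classical in
/-- The total weight of the level `n` cylinders of `K i` that meet `U`, when the cylinder given by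
a path from `i` to `j` of length `n` has weight `v j / m ^ n`. -/
noncomputable def cylinderMass (S : ∀ ⦃i j : Fin p⦄, E i j → X → X) (K : Fin p → Set X)
    (v : Fin p → ℝ) (m : ℝ) : ℕ → Fin p → Set X → ℝ
  | 0, i, U => if (U ∩ K i).Nonempty then v i else 0
  | n + 1, i, U => m⁻¹ * ∑ a : (Σ j, E i j), cylinderMass S K v m n a.1 (S a.2 ⁻¹' U)

variable {S : ∀ ⦃i j : Fin p⦄, E i j → X → X} {K : Fin p → Set X} {v : Fin p → ℝ} {m : ℝ}

lemma cylinderMass_nonneg (hv : ∀ i, 0 ≤ v i) (hm : 0 < m) (n : ℕ) (i : Fin p) (U : Set X) :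
    0 ≤ cylinderMass S K v m n i U := by
  induction n generalizing i U with
  | zero => rw [cylinderMass]; split_ifs; exacts [hv i, le_rfl]
  | succ n ih =>
    exact mul_nonneg (inv_nonneg.2 hm.le) (Finset.sum_nonneg fun a _ => ih _ _)

lemma cylinderMass_le (hv : ∀ i, 0 ≤ v i) (hm : 0 < m)
    (hvm : ∀ i, ∑ a : (Σ j, E i j), v a.1 = m * v i) (n : ℕ) (i : Fin p) (U : Set X) :
    cylinderMass S K v m n i U ≤ v i := by
  induction n generalizing i U with
  | zero => rw [cylinderMass]; split_ifs; exacts [le_rfl, hv i]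
  | succ n ih =>
    rw [cylinderMass, inv_mul_le_iff₀ hm, ← hvm i]
    exact Finset.sum_le_sum fun a _ => ih _ _

lemma cylinderMass_biUnion_le (hv : ∀ i, 0 ≤ v i) (hm : 0 < m) {ι : Type*} (F : Finset ι)
    (n : ℕ) (i : Fin p) (U : ι → Set X) :
    cylinderMass S K v m n i (⋃ k ∈ F, U k) ≤ ∑ k ∈ F, cylinderMass S K v m n i (U k) := by
  induction n generalizing i U with
  | zero =>
    by_cases h : ((⋃ k ∈ F, U k) ∩ K i).Nonempty
    · obtain ⟨x, hx, hxK⟩ := h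
      obtain ⟨k, hk, hxk⟩ := mem_iUnion₂.1 hx
      calc cylinderMass S K v m 0 i (⋃ k ∈ F, U k) = cylinderMass S K v m 0 i (U k) := by
            rw [cylinderMass, cylinderMass, if_pos ⟨x, hx, hxK⟩, if_pos ⟨x, hxk, hxK⟩]
        _ ≤ _ := Finset.single_le_sum
            (fun k _ => cylinderMass_nonneg (S := S) hv hm 0 i (U k)) hk
    · rw [cylinderMass, if_neg h]
      exact Finset.sum_nonneg fun k _ => cylinderMass_nonneg hv hm 0 i (U k)
  | succ n ih =>
    simp only [cylinderMass]
    rw [← Finset.mul_sum, Finset.sum_comm]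
    refine mul_le_mul_of_nonneg_left (Finset.sum_le_sum fun a _ => ?_) (inv_nonneg.2 hm.le)
    rw [preimage_iUnion₂]
    exact ih _ _

end CylinderMass

/-! ### Separation, mass estimates and the two bounds on Hausdorff measure. -/

section GraphDirected

variable {p : ℕ} {X : Type*} [MetricSpace X] {E : Fin p → Fin p → Type*}
  [∀ i j, Fintype (E i j)] {r : ℝ} {S : ∀ ⦃i j : Fin p⦄, E i j → X → X} {K : Fin p → Set X}
  {v : Fin p → ℝ} {m : ℝ}

/-- The Hausdorff measures of dust-like sets satisfy the eigenvector equation. -/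
lemma IsDustLike.hausdorffMeasure_eq [MeasurableSpace X] [BorelSpace X]
    (hK : IsDustLike r S K) (hr : 0 < r) {s : ℝ} (hs : 0 ≤ s) (i : Fin p) :
    μH[s] (K i) = ENNReal.ofReal (r ^ s) * ∑ a : (Σ j, E i j), μH[s] (K a.1) := by
  conv_lhs => rw [hK.toIsGraphDirectedSets.eq_iUnion_sigma i]
  rw [measure_iUnion (hK.disjoint i), tsum_fintype, Finset.mul_sum]
  · exact Finset.sum_congr rfl fun a _ =>
      (hK.isSimilitude _ _ a.2).hausdorffMeasure_image hr hs _
  · exact fun a => ((hK.isCompact a.1).image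
      ((hK.isSimilitude _ _ a.2).lipschitzWith hr).continuous).measurableSet

/-- Distinct first-level pieces of dust-like sets are uniformly separated. -/
lemma IsDustLike.exists_separation (hK : IsDustLike r S K) (hr : 0 < r) :
    ∃ δ : ℝ, 0 < δ ∧ ∀ (i : Fin p) (a b : Σ j, E i j), a ≠ b →
      ∀ x ∈ S a.2 '' K a.1, ∀ y ∈ S b.2 '' K b.1, δ < dist x y := by
  -- Phrasing the claim as eventual for `δ → 0⁺` lets the finitely many pairs of pieces share one
  -- `δ`.
  have h : ∀ᶠ δ in 𝓝[>] (0 : ℝ), ∀ (i : Fin p) (a b : Σ j, E i j), a ≠ b →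
      ∀ x ∈ S a.2 '' K a.1, ∀ y ∈ S b.2 '' K b.1, δ < dist x y := by
    simp only [eventually_all]
    intro i a b hab
    have hc : ∀ a : (Σ j, E i j), IsCompact (S a.2 '' K a.1) := fun a =>
      (hK.isCompact a.1).image ((hK.isSimilitude _ _ a.2).lipschitzWith hr).continuous
    obtain ⟨ρ, hρ, h⟩ := exists_pos_forall_lt_edist (hc a) (hc b).isClosed (hK.disjoint i hab)
    filter_upwards [Ioo_mem_nhdsGT (show (0 : ℝ) < ρ from hρ)] with δ hδ x hx y hy
    have h1 := h x hx y hy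
    rw [edist_nndist, ENNReal.coe_lt_coe] at h1
    exact hδ.2.trans h1
  obtain ⟨δ, h1, h2⟩ := (h.and self_mem_nhdsWithin).exists
  exact ⟨δ, h2, h1⟩

lemma cylinderMass_eq_of_subset (hK : IsGraphDirectedSets S K) (hm : 0 < m)
    (hvm : ∀ i, ∑ a : (Σ j, E i j), v a.1 = m * v i) (n : ℕ) (i : Fin p) (U : Set X)
    (hU : K i ⊆ U) : cylinderMass S K v m n i U = v i := by
  induction n generalizing i U with
  | zero =>
    rw [cylinderMass, if_pos]
    rw [inter_eq_self_of_subset_right hU]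
    exact hK.nonempty i
  | succ n ih =>
    rw [cylinderMass, inv_mul_eq_iff_eq_mul₀ hm.ne', ← hvm i]
    refine Finset.sum_congr rfl fun a _ => ih _ _ ?_
    rw [← image_subset_iff]
    refine Subset.trans ?_ hU
    rw [hK.eq_iUnion_sigma i]
    exact subset_iUnion (fun a : (Σ j, E i j) => S a.2 '' K a.1) a

lemma cylinderMass_eq_zero (hK : IsGraphDirectedSets S K) (n : ℕ) (i : Fin p) (U : Set X)
    (hU : ¬ (U ∩ K i).Nonempty) : cylinderMass S K v m n i U = 0 := by
  induction n generalizing i U with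
  | zero => rw [cylinderMass, if_neg hU]
  | succ n ih =>
    rw [cylinderMass, Finset.sum_eq_zero, mul_zero]
    rintro a -
    refine ih _ _ fun ⟨x, hx, hxK⟩ => hU ⟨S a.2 x, hx, ?_⟩
    rw [hK.eq_iUnion_sigma i]
    exact mem_iUnion.2 ⟨a, mem_image_of_mem _ hxK⟩

/-- The mass distribution estimate. -/
lemma cylinderMass_le_diam [CompactSpace X] (hK : IsDustLike r S K) (hr : 0 < r) {s δ M : ℝ}
    (hs : 0 ≤ s) (hrs : r ^ s = m⁻¹) (hδ : 0 < δ)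
    (hsep : ∀ (i : Fin p) (a b : Σ j, E i j), a ≠ b →
      ∀ x ∈ S a.2 '' K a.1, ∀ y ∈ S b.2 '' K b.1, δ < dist x y)
    (hv : ∀ i, 0 ≤ v i) (hm : 0 < m) (hvm : ∀ i, ∑ a : (Σ j, E i j), v a.1 = m * v i)
    (hM₀ : 0 ≤ M) (hM : ∀ i, v i ≤ M) (n : ℕ) (i : Fin p) (U : Set X) :
    cylinderMass S K v m n i U ≤ M * max ((diam U / δ) ^ s) (m⁻¹ ^ n) := by
  induction n generalizing i U with
  | zero =>
    refine (cylinderMass_le hv hm hvm 0 i U).trans ((hM i).trans (le_mul_of_one_le_right hM₀ ?_))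
    simp
  | succ n ih =>
    have hnn : 0 ≤ M * max ((diam U / δ) ^ s) (m⁻¹ ^ (n + 1)) := by positivity
    -- A set of diameter at least `δ` satisfies the trivial bound `v i ≤ M`. A smaller one meets at
    -- most one first-level piece, so a single summand survives.
    rcases le_or_gt δ (diam U) with hU | hU
    · refine (cylinderMass_le hv hm hvm (n + 1) i U).trans
        ((hM i).trans (le_mul_of_one_le_right hM₀ (le_max_of_le_left ?_)))
      exact Real.one_le_rpow ((one_le_div hδ).2 hU) hs
    by_cases hne : ∃ a : (Σ j, E i j), ((S a.2 ⁻¹' U) ∩ K a.1).Nonempty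
    · obtain ⟨a, x, hxU, hxK⟩ := hne
      rw [cylinderMass, Fintype.sum_eq_single a]
      · calc m⁻¹ * cylinderMass S K v m n a.1 (S a.2 ⁻¹' U)
            ≤ m⁻¹ * (M * max ((diam (S a.2 ⁻¹' U) / δ) ^ s) (m⁻¹ ^ n)) := by
              gcongr; exact ih _ _
          _ ≤ m⁻¹ * (M * max ((diam U / r / δ) ^ s) (m⁻¹ ^ n)) := by
              gcongr
              exact (hK.isSimilitude _ _ a.2).diam_preimage_le hr U
          _ = M * max ((diam U / δ) ^ s) (m⁻¹ ^ (n + 1)) := by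
              -- The weight factor `m⁻¹ = r ^ s` exactly absorbs the growth of the diameter by `1 /
              -- r` under pullback, so the constant does not deteriorate with `n`.
              rw [mul_left_comm, mul_max_of_nonneg _ _ (inv_nonneg.2 hm.le), pow_succ', ← hrs,
                div_right_comm, ← Real.mul_rpow hr.le (by positivity), mul_div_cancel₀ _ hr.ne']
      · refine fun b hb => cylinderMass_eq_zero hK.toIsGraphDirectedSets n _ _ ?_
        rintro ⟨y, hyU, hyK⟩
        have h1 := hsep i b a hb _ (mem_image_of_mem _ hyK) _ (mem_image_of_mem _ hxK)
        have h2 := dist_le_diam_of_mem (isBounded_of_compactSpace (s := U)) hyU hxU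
        linarith
    · rw [cylinderMass, Finset.sum_eq_zero, mul_zero]
      · exact hnn
      · exact fun a _ => cylinderMass_eq_zero hK.toIsGraphDirectedSets n _ _
          fun h => hne ⟨a, h⟩

/-- Subadditivity of the weights is applied at every level `n`. As the cover is finite, letting `n →
∞` removes the errors `m⁻¹ ^ n`. -/
lemma IsDustLike.le_sum_diam_of_finite_cover [CompactSpace X] (hK : IsDustLike r S K) (hr : 0 < r)
    {s : ℝ} (hs : 0 ≤ s) (hrs : r ^ s = m⁻¹) (hm : 1 < m) (hv : ∀ i, 0 ≤ v i)
    (hvm : ∀ i, ∑ a : (Σ j, E i j), v a.1 = m * v i) :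
    ∃ c : ℝ, 0 ≤ c ∧ ∀ (i : Fin p) (F : Finset ℕ) (U : ℕ → Set X), K i ⊆ ⋃ k ∈ F, U k →
      v i ≤ c * ∑ k ∈ F, diam (U k) ^ s := by
  have hm₀ : 0 < m := zero_lt_one.trans hm
  obtain ⟨δ, hδ, hsep⟩ := hK.exists_separation hr
  have hM : ∀ i, v i ≤ ∑ j, v j := fun i =>
    Finset.single_le_sum (fun j _ => hv j) (Finset.mem_univ i)
  have hM₀ : 0 ≤ ∑ j, v j := Finset.sum_nonneg fun j _ => hv j
  set M := ∑ j, v j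
  refine ⟨M * (δ ^ s)⁻¹, by positivity, fun i F U hU => ?_⟩
  have hle : ∀ n : ℕ, v i ≤ ∑ k ∈ F, M * max ((diam (U k) / δ) ^ s) (m⁻¹ ^ n) := fun n => by
    rw [← cylinderMass_eq_of_subset hK.toIsGraphDirectedSets hm₀ hvm n i _ hU]
    exact (cylinderMass_biUnion_le hv hm₀ F n i U).trans (Finset.sum_le_sum fun k _ =>
      cylinderMass_le_diam hK hr hs hrs hδ hsep hv hm₀ hvm hM₀ hM n i (U k))
  have hlim : Tendsto (fun n : ℕ => ∑ k ∈ F, M * max ((diam (U k) / δ) ^ s) (m⁻¹ ^ n)) atTop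
      (𝓝 (∑ k ∈ F, M * max ((diam (U k) / δ) ^ s) 0)) :=
    tendsto_finsetSum _ fun k _ => (tendsto_const_nhds.max
      (tendsto_pow_atTop_nhds_zero_of_lt_one (inv_nonneg.2 hm₀.le) (inv_lt_one_of_one_lt₀ hm))
      ).const_mul M
  refine (ge_of_tendsto' hlim hle).trans_eq ?_
  rw [Finset.mul_sum]
  refine Finset.sum_congr rfl fun k _ => ?_
  rw [max_eq_left (by positivity), Real.div_rpow diam_nonneg hδ.le]
  ring

/-- Compactness reduces to finite covers: each set is thickened to an open one, at a cost `η k` in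
the `s`-sum with total below an arbitrary `ε`. -/
lemma IsDustLike.le_tsum_diam_of_cover [CompactSpace X] (hK : IsDustLike r S K) (hr : 0 < r)
    {s : ℝ} (hs : 0 < s) (hrs : r ^ s = m⁻¹) (hm : 1 < m) (hv : ∀ i, 0 ≤ v i)
    (hvm : ∀ i, ∑ a : (Σ j, E i j), v a.1 = m * v i) :
    ∃ c : ℝ, 0 ≤ c ∧ ∀ (i : Fin p) (t : ℕ → Set X), K i ⊆ ⋃ k, t k →
      ENNReal.ofReal (v i) ≤ ENNReal.ofReal c * ∑' k, ediam (t k) ^ s := by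
  obtain ⟨c, hc, hfin⟩ := hK.le_sum_diam_of_finite_cover hr hs.le hrs hm hv hvm
  refine ⟨c, hc, fun i t ht => ?_⟩
  have key : ∀ ε : ℝ≥0, 0 < ε →
      ENNReal.ofReal (v i) ≤ ENNReal.ofReal c * (∑' k, ediam (t k) ^ s + ε) := fun ε hε => by
    obtain ⟨η, hη, hηε⟩ := ENNReal.exists_pos_sum_of_countable
      (ENNReal.coe_ne_zero.2 hε.ne') ℕ
    have hρ : ∀ k, ∃ ρ : ℝ, 0 < ρ ∧ (diam (t k) + 2 * ρ) ^ s < diam (t k) ^ s + η k := fun k => by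
      have hcont : Continuous fun ρ : ℝ => (diam (t k) + 2 * ρ) ^ s :=
        Continuous.rpow_const (by fun_prop) fun _ => Or.inr hs.le
      have h := (hcont.tendsto 0).eventually_lt_const
        (u := diam (t k) ^ s + η k) (by simpa using hη k)
      obtain ⟨ρ, h1, h2⟩ := ((h.filter_mono nhdsWithin_le_nhds).and
        (self_mem_nhdsWithin (s := Ioi (0 : ℝ)))).exists
      exact ⟨ρ, h2, h1⟩
    choose ρ hρ₀ hρ using hρ
    obtain ⟨F, hF⟩ := (hK.isCompact i).elim_finite_subcover (fun k => thickening (ρ k) (t k))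
      (fun k => isOpen_thickening)
      (ht.trans (iUnion_mono fun k => self_subset_thickening (hρ₀ k) _))
    have h1 : v i ≤ c * ∑ k ∈ F, (diam (t k) ^ s + η k) := by
      refine (hfin i F _ hF).trans ?_
      gcongr with k
      exact (Real.rpow_le_rpow diam_nonneg (diam_thickening_le _ (hρ₀ k).le) hs.le).trans
        (hρ k).le
    have hterm : ∀ k, ENNReal.ofReal (diam (t k) ^ s + η k) = ediam (t k) ^ s + η k := fun k => by
      rw [ENNReal.ofReal_add (by positivity) (η k).coe_nonneg, ENNReal.ofReal_coe_nnreal,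
        ← ENNReal.ofReal_rpow_of_nonneg diam_nonneg hs.le, diam,
        ENNReal.ofReal_toReal (isBounded_of_compactSpace (s := t k)).ediam_ne_top]
    calc ENNReal.ofReal (v i) ≤ ENNReal.ofReal (c * ∑ k ∈ F, (diam (t k) ^ s + η k)) :=
          ENNReal.ofReal_le_ofReal h1
      _ = ENNReal.ofReal c * ∑ k ∈ F, (ediam (t k) ^ s + η k) := by
          rw [ENNReal.ofReal_mul hc, ENNReal.ofReal_sum_of_nonneg fun k _ => by positivity]
          simp only [hterm]
      _ ≤ ENNReal.ofReal c * ∑' k, (ediam (t k) ^ s + η k) := by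
          gcongr
          exact ENNReal.sum_le_tsum F
      _ ≤ _ := by
          rw [ENNReal.tsum_add]
          gcongr
  have hlim : Tendsto (fun ε : ℝ≥0 => ENNReal.ofReal c * (∑' k, ediam (t k) ^ s + ε)) (𝓝[>] 0)
      (𝓝 (ENNReal.ofReal c * (∑' k, ediam (t k) ^ s + (0 : ℝ≥0)))) := by
    refine ENNReal.Tendsto.const_mul ?_ (Or.inr ENNReal.ofReal_ne_top)
    refine tendsto_const_nhds.add ?_
    exact (ENNReal.continuous_coe.tendsto 0).mono_left nhdsWithin_le_nhds
  have := ge_of_tendsto hlim (eventually_mem_nhdsWithin.mono fun ε hε => key ε hε)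
  simpa using this

lemma IsDustLike.hausdorffMeasure_pos [CompactSpace X] [MeasurableSpace X] [BorelSpace X]
    (hK : IsDustLike r S K) (hr : 0 < r)
    {s : ℝ} (hs : 0 < s) (hrs : r ^ s = m⁻¹) (hm : 1 < m) (hv : ∀ i, 0 < v i)
    (hvm : ∀ i, ∑ a : (Σ j, E i j), v a.1 = m * v i) (i : Fin p) :
    0 < μH[s] (K i) := by
  obtain ⟨c, hc, h⟩ := hK.le_tsum_diam_of_cover hr hs hrs hm (fun i => (hv i).le) hvm
  have hle : ENNReal.ofReal (v i) / ENNReal.ofReal c ≤ μH[s] (K i) := by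
    rw [Measure.hausdorffMeasure_apply]
    -- The scale `1` is arbitrary: the bound holds for covers of any mesh.
    refine le_iSup₂_of_le 1 one_pos (le_iInf₂ fun t ht => le_iInf fun _ => ?_)
    refine ENNReal.div_le_of_le_mul' ((h i t ht).trans_eq ?_)
    congr 2 with k
    -- The definition of `μH[s]` discards empty sets; since `0 < s`, they contribute `0 ^ s = 0`
    -- here as well.
    rcases (t k).eq_empty_or_nonempty with h0 | h0
    · simp [h0, hs]
    · simp [h0]
  exact (ENNReal.div_pos (by simpa using hv i) ENNReal.ofReal_ne_top).trans_le hle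

/-- The covers of graph-directed sets by cylinders of level `n`. -/
lemma IsDustLike.exists_cylinder_cover [CompactSpace X] (hK : IsDustLike r S K) (hr : 0 < r)
    {w : ℝ} (hw : ∀ i, w ≤ v i)
    (hvm : ∀ i, ∑ a : (Σ j, E i j), v a.1 = m * v i) (n : ℕ) (i : Fin p) :
    ∃ (N : ℕ) (t : Fin N → Set X), K i ⊆ ⋃ k, t k ∧
      (∀ k, ediam (t k) ≤ (r.toNNReal : ℝ≥0∞) ^ n * ediam (univ : Set X)) ∧
      N * w ≤ m ^ n * v i := by
  induction n generalizing i with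
  | zero =>
    exact ⟨1, fun _ => univ, fun x _ => mem_iUnion.2 ⟨0, mem_univ x⟩, by simp, by simpa using hw i⟩
  | succ n ih =>
    choose N t hcov hdiam hN using ih
    let e := Fintype.equivFin (Σ a : (Σ j, E i j), Fin (N a.1))
    refine ⟨_, fun k => S (e.symm k).1.2 '' t _ (e.symm k).2, ?_, fun k => ?_, ?_⟩
    · intro x hx
      rw [hK.toIsGraphDirectedSets.eq_iUnion_sigma i] at hx
      obtain ⟨a, y, hy, rfl⟩ := mem_iUnion.1 hx
      obtain ⟨k, hk⟩ := mem_iUnion.1 (hcov a.1 hy)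
      refine mem_iUnion.2 ⟨e ⟨a, k⟩, ?_⟩
      rw [e.symm_apply_apply]
      exact mem_image_of_mem _ hk
    · refine (((hK.isSimilitude _ _ (e.symm k).1.2).lipschitzWith hr).ediam_image_le _).trans ?_
      rw [pow_succ', mul_assoc]
      gcongr
      exact hdiam _ _
    · rw [Fintype.card_sigma]
      simp only [Fintype.card_fin, Nat.cast_sum]
      -- The eigenvector equation turns the bounds for the targets of the edges into the bound for
      -- `i`.
      rw [Finset.sum_mul, pow_succ, mul_assoc, ← hvm i, Finset.mul_sum]
      exact Finset.sum_le_sum fun a _ => hN a.1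

lemma IsDustLike.hausdorffMeasure_lt_top [CompactSpace X] [MeasurableSpace X] [BorelSpace X]
    (hK : IsDustLike r S K) (hr : 0 < r) (hr₁ : r < 1)
    {s : ℝ} (hs : 0 ≤ s) (hrs : r ^ s = m⁻¹) (hm : 0 < m) (hv : ∀ i, 0 < v i)
    (hvm : ∀ i, ∑ a : (Σ j, E i j), v a.1 = m * v i) (i : Fin p) :
    μH[s] (K i) < ∞ := by
  have : Nonempty (Fin p) := ⟨i⟩
  obtain ⟨j₀, hj₀⟩ := Finite.exists_min v
  have hw := hv j₀
  choose N t hcov hdiam hN using fun n =>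
    hK.exists_cylinder_cover hr hj₀ hvm n i
  have hD : ediam (univ : Set X) ≠ ∞ := (isBounded_of_compactSpace (s := univ)).ediam_ne_top
  have hq : (r.toNNReal : ℝ≥0∞) < 1 := by
    rw [← ENNReal.coe_one, ENNReal.coe_lt_coe]
    simpa using hr₁
  have hqs : (r.toNNReal : ℝ≥0∞) ^ s = ENNReal.ofReal m⁻¹ := by
    rw [← hrs, ← ENNReal.ofReal_rpow_of_pos hr]
    rfl
  have htend : Tendsto (fun n : ℕ => (r.toNNReal : ℝ≥0∞) ^ n * ediam (univ : Set X)) atTop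
      (𝓝 0) := by
    have := ENNReal.Tendsto.mul_const (ENNReal.tendsto_pow_atTop_nhds_zero_of_lt_one hq)
      (b := ediam (univ : Set X)) (Or.inr hD)
    simpa using this
  refine (Measure.hausdorffMeasure_le_liminf_sum s (K i) _ htend t
    (Eventually.of_forall hdiam) (Eventually.of_forall hcov)).trans_lt ?_
  -- The factor `(r ^ n) ^ s = m⁻¹ ^ n` cancels the growth `m ^ n` of the number of sets.
  have hbound : ∀ n, ∑ k, ediam (t n k) ^ s ≤
      ENNReal.ofReal (v i / v j₀) * ediam (univ : Set X) ^ s := fun n => by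
    calc ∑ k, ediam (t n k) ^ s
        ≤ ∑ k : Fin (N n), ((r.toNNReal : ℝ≥0∞) ^ n * ediam (univ : Set X)) ^ s := by
          gcongr with k; exact hdiam n k
      _ = ENNReal.ofReal (N n * m⁻¹ ^ n) * ediam (univ : Set X) ^ s := by
          rw [Finset.sum_const, Finset.card_univ, Fintype.card_fin, nsmul_eq_mul,
            ENNReal.mul_rpow_of_nonneg _ _ hs, ← ENNReal.rpow_natCast, ← ENNReal.rpow_mul,
            mul_comm (n : ℝ) s, ENNReal.rpow_mul, hqs, ENNReal.rpow_natCast,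
            ENNReal.ofReal_mul (Nat.cast_nonneg _), ENNReal.ofReal_natCast,
            ENNReal.ofReal_pow (inv_nonneg.2 hm.le), mul_assoc]
      _ ≤ _ := by
          gcongr
          rw [inv_pow, ← div_eq_mul_inv, div_le_div_iff₀ (by positivity) hw, mul_comm (v i)]
          exact hN n
  refine (liminf_le_liminf (Eventually.of_forall hbound)).trans_lt ?_
  rw [liminf_const]
  exact ENNReal.mul_lt_top ENNReal.ofReal_lt_top
    (ENNReal.rpow_lt_top_of_nonneg hs hD)

end GraphDirected

theorem mainTheorem5 {p : ℕ} {X : Type*} [MetricSpace X] [CompactSpace X]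
    [MeasurableSpace X] [BorelSpace X]
    (E : Fin p → Fin p → Type*) [∀ i j, Fintype (E i j)]
    (r : ℝ) (hr₀ : 0 < r) (hr₁ : r < 1)
    (S : ∀ ⦃i j : Fin p⦄, E i j → X → X) (K : Fin p → Set X)
    (hK : IsDustLike r S K) (m : ℕ) (hm : 2 ≤ m) :
    (∃ v : Fin p → ℝ, (∀ i, 0 < v i) ∧ adjacencyMatrix E *ᵥ v = (m : ℝ) • v) ↔
      ∀ i, 0 < μH[-Real.log m / Real.log r] (K i) ∧
        μH[-Real.log m / Real.log r] (K i) < ∞ := by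
  have hm₁ : (1 : ℝ) < m := by exact_mod_cast hm
  have hm₀ : (0 : ℝ) < m := zero_lt_one.trans hm₁
  have hs : 0 < -Real.log m / Real.log r :=
    div_pos_of_neg_of_neg (neg_lt_zero.2 (Real.log_pos hm₁)) (Real.log_neg hr₀ hr₁)
  have hrs := rpow_neg_log_div_log hr₀ hr₁ hm₀
  generalize -Real.log m / Real.log r = s at hs hrs
  constructor
  · rintro ⟨v, hv, hAv⟩ i
    have hvm : ∀ i, ∑ a : (Σ j, E i j), v a.1 = m * v i := fun i => by
      rw [← adjacencyMatrix_mulVec, hAv, Pi.smul_apply, smul_eq_mul]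
    exact ⟨hK.hausdorffMeasure_pos hr₀ hs hrs hm₁ hv hvm i,
      hK.hausdorffMeasure_lt_top hr₀ hr₁ hs.le hrs hm₀ hv hvm i⟩
  · intro h
    refine ⟨fun i => (μH[s] (K i)).toReal,
      fun i => ENNReal.toReal_pos (h i).1.ne' (h i).2.ne, ?_⟩
    ext i
    rw [adjacencyMatrix_mulVec, Pi.smul_apply, smul_eq_mul, hK.hausdorffMeasure_eq hr₀ hs.le i,
      hrs, ENNReal.toReal_mul, ENNReal.toReal_ofReal (by positivity),
      ENNReal.toReal_sum fun a _ => (h a.1).2.ne, mul_inv_cancel_left₀ hm₀.ne']
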